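/- Consider the stochastic bandit problem with $k\ge 2$ actions and horizon $T$. An environment $\mathcal D=(\mathcal D_1,\dots,\mathcal D_k)$ consists of probability distributions on $\mathbb R$ with means $\mu_1,\dots,\mu_k$ that are standardized sub-Gaussian, i.e. $\mathbb E_{X\sim\mathcal D_i}\,e^{\lambda(X-\mu_i)}\le e^{\lambda^2/2}$ for all $\lambda\in\mathbb R$, and satisfy $|\mu_i-\mu_j|\le 1$ for all $i,j$. In each round $t=1,\dots,T$ a policy $\pi$ chooses an action $\pi_t\in\{1,\dots,k\}$, possibly at random, based on the past actions and observed rewards, and then observes a reward drawn from $\mathcal D_{\pi_t}$, independently of the past given $\pi_t$. The policy is an $S$-switch policy if, in every environment, almost surely at most $S$ of the indices $t\in\{1,\dots,T-1\}$ satisfy $\pi_t\ne\pi_{t+1}$. Let $$R^\pi_{\mathcal D}(T)=T\max_i\mu_i-\mathbb E^\pi_{\mathcal D}\Big[\sum_{t=1}^T\mu_{\pi_t}\Big],\qquad \Delta(\mathcal D)=\min_{i\ne i^*}|\mu_{i^*}-\mu_i|,\quad i^*\in\arg\max_i\mu_i,$$ and let $m(S)=\max\{0,\lfloor (S-1)/(k-1)\rfloor\}$.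 There exists an absolute constant $C>0$ such that for all integers $k\ge2$, $S\ge0$, $T\ge1$ and every $S$-switch policy $\pi$, if $m(S)\le\log_2(T/k)$, then $$\sup_{\mathcal D:\ \Delta(\mathcal D)\in(0,1]}\Delta(\mathcal D)\,R^\pi_{\mathcal D}(T)\ \ge\ C\,k^{-\frac32-\frac1{m(S)+1}}\,(m(S)+1)^{-2}\,T^{\frac1{m(S)+1}} .$$ -/

import Mathlib

open MeasureTheory ProbabilityTheory

namespace BwSC

noncomputable section

/-- An environment for the `k`-armed bandit: a reward distribution for each action. Each of them is
a probability measure on `ℝ` that is standardized sub-Gaussian, i.e.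
`∫ exp (s (x - μᵢ)) ≤ exp (s² / 2)` for all real `s`, where `μᵢ` is its mean, and any two means
differ by at most `1`. -/
structure Env (k : ℕ) where
  /-- the reward distribution of each action -/
  dist : Fin k → Measure ℝ
  isProb : ∀ i, IsProbabilityMeasure (dist i)
  subGaussian : ∀ i, HasSubgaussianMGF (fun x => x - ∫ y, y ∂(dist i)) 1 (dist i)
  spread_le_one : ∀ i j, |(∫ y, y ∂(dist i)) - ∫ y, y ∂(dist j)| ≤ 1

/-- The mean reward `μᵢ` of action `i`. -/
def Env.mean {k : ℕ} (D : Env k) (i : Fin k) : ℝ := ∫ y, y ∂(D.dist i)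

/-- The kernel that sends an action to its reward distribution. -/
def Env.rewardKernel {k : ℕ} (D : Env k) : Kernel (Fin k) ℝ where
  toFun := D.dist
  measurable' := measurable_of_countable _

instance Env.isMarkovKernel_rewardKernel {k : ℕ} (D : Env k) : IsMarkovKernel D.rewardKernel :=
  ⟨D.isProb⟩

/-- Histories of length `n`: the actions chosen and the rewards observed in `n` rounds. -/
abbrev History (k n : ℕ) : Type := Fin n → Fin k × ℝ

/-- A non-anticipating (possibly randomized) learning policy: for each `n`, a probability kernel
from the histories of the first `n` rounds to the action chosen in the next round. With a horizon of
`T` rounds only the kernels with `n < T` are used. -/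
structure Policy (k : ℕ) where
  /-- the conditional law of the next action given the history -/
  act : (n : ℕ) → Kernel (History k n) (Fin k)
  isMarkov : ∀ n, IsMarkovKernel (act n)

instance Policy.isMarkovKernel_act {k : ℕ} (π : Policy k) (n : ℕ) : IsMarkovKernel (π.act n) :=
  π.isMarkov n

/-- One round: given the history, draw an action from the policy, then, independently of the past,
a reward from the distribution of that action. -/
def stepKernel {k : ℕ} (π : Policy k) (D : Env k) (n : ℕ) :
    Kernel (History k n) (Fin k × ℝ) :=
  π.act n ⊗ₖ D.rewardKernel.comap Prod.snd measurable_snd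

instance isMarkovKernel_stepKernel {k : ℕ} (π : Policy k) (D : Env k) (n : ℕ) :
    IsMarkovKernel (stepKernel π D n) := by
  unfold stepKernel; infer_instance

/-- The law of the history of the first `n` rounds under policy `π` in environment `D`. -/
def law {k : ℕ} (π : Policy k) (D : Env k) : (n : ℕ) → Measure (History k n)
  | 0 => Measure.dirac Fin.elim0
  | n + 1 => (law π D n ⊗ₘ stepKernel π D n).map
      (fun p => (Fin.snoc p.1 p.2 : History k (n + 1)))

lemma measurable_snoc (k n : ℕ) :
    Measurable (fun p : History k n × (Fin k × ℝ) => (Fin.snoc p.1 p.2 : History k (n + 1))) := by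
  refine measurable_pi_lambda _ (fun i => ?_)
  refine Fin.lastCases ?_ (fun j => ?_) i
  · simpa using measurable_snd
  · simp only [Fin.snoc_castSucc]
    exact (measurable_pi_apply j).comp measurable_fst

instance isProbabilityMeasure_law {k : ℕ} (π : Policy k) (D : Env k) (n : ℕ) :
    IsProbabilityMeasure (law π D n) := by
  induction n with
  | zero => unfold law; infer_instance
  | succ n ih =>
    unfold law
    exact Measure.isProbabilityMeasure_map (measurable_snoc k n).aemeasurable

/-- The number of switches in a history of `T` rounds, i.e. the total switching cost under unit
switching costs. -/
def numSwitches {k T : ℕ} (h : History k T) : ℕ :=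
  ∑ t : Fin (T - 1),
    if (h ⟨t, by omega⟩).1 = (h ⟨t + 1, by omega⟩).1 then 0 else 1

/-- `S`-switch policies for the horizon `T`: in every environment, almost surely at most `S`
switches are made. -/
def IsSwitchPolicy {k : ℕ} (S T : ℕ) (π : Policy k) : Prop :=
  ∀ D : Env k, ∀ᵐ h ∂(law π D T), numSwitches h ≤ S

/-- The distribution-dependent regret `T μ* - E[∑ₜ μ_{πₜ}]`. -/
def regret {k : ℕ} (π : Policy k) (D : Env k) (T : ℕ) : ℝ :=
  T * (⨆ i, D.mean i) - ∫ h, ∑ t, D.mean (h t).1 ∂(law π D T)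

/-- Action `i` maximizes the mean reward. -/
def Env.IsOptimal {k : ℕ} (D : Env k) (i : Fin k) : Prop := ∀ j, D.mean j ≤ D.mean i

/-- The least distance between the mean of action `i` and the mean of another action. For an optimal
action `i` this is the gap `Δ(D)`; it does not depend on the choice of the optimal action, since it
vanishes if there are several of them. -/
def Env.gap {k : ℕ} (D : Env k) (i : Fin k) : ℝ :=
  ⨅ j : {j : Fin k // j ≠ i}, |D.mean i - D.mean j|

/-- `m(S) = ⌊(S - 1) / (k - 1)⌋`, where the floor of a negative number is `0`. -/
def switchIndex (k S : ℕ) : ℕ := ⌊((S : ℝ) - 1) / ((k : ℝ) - 1)⌋₊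

end

end BwSC

/-! Cut the horizon into `m + 1` blocks followed by a final stretch. In the base environment `i₁`
has mean `2d`, `i₂` has mean `d` and all other actions have mean `0`. Visiting every action in each
block costs almost the whole budget `(m + 1) (k - 1)`, so on almost every history
(`unvisited_or_abandoned_or_exhausted`) some block `j` misses some action `c`, or `i₁` is never
played in the final stretch, or the budget is spent when `i₁` is first played in the last block.
These are `(m + 1) k + 2` events, so one has probability at least `1 / (2k(m + 1))`.

Each event hurts in a suitable environment. In the first case `c` is raised to be the best action by
`δ j`, and it is missed throughout block `j`. In the second the base environment itself serves. In
the third `i₁` is lowered to `0`, and the policy is then locked into it although `i₂` is better by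
`d`.

The altered action's rewards matter to the event only before round `t j` (resp. `t m`), since the
event is settled once that action is next played. The change of measure (`lintegral_law_rpow_le`)
thus costs a constant when `δ j ^ 2 * t j` is bounded. It uses Hölder with exponents `3/2` and `3`,
so a probability `p` becomes `(p / e) ^ (3/2)`, the source of `k ^ (-3/2)`. Blocks ending near `r ^
j`, with `r ^ (m + 1) = T / k` and `δ j` of order `r ^ (-j/2)`, make every loss `δ ^ 2 * length` of
order `r`. -/

namespace BwSC

/-! ### Counting switches -/

/-- The number of switches of the sequence `a` between the rounds `x` and `y`. -/
def switchesIn {k : ℕ} (a : ℕ → Fin k) (x y : ℕ) : ℕ :=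
  ((Finset.Ico x y).filter fun t => a t ≠ a (t + 1)).card

lemma switchesIn_add {k : ℕ} (a : ℕ → Fin k) {x y z : ℕ} (hxy : x ≤ y) (hyz : y ≤ z) :
    switchesIn a x y + switchesIn a y z = switchesIn a x z := by
  unfold switchesIn
  rw [← Finset.Ico_union_Ico_eq_Ico hxy hyz, Finset.filter_union, Finset.card_union_of_disjoint]
  exact Finset.disjoint_filter_filter (Finset.Ico_disjoint_Ico_consecutive x y z)

lemma exists_switch_to {k : ℕ} (a : ℕ → Fin k) (c : Fin k) {v w : ℕ} (hvw : v ≤ w)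
    (hv : a v ≠ c) (hw : a w = c) :
    ∃ t, v ≤ t ∧ t < w ∧ a t ≠ a (t + 1) ∧ a (t + 1) = c := by
  induction w, hvw using Nat.le_induction with
  | base => exact absurd hw hv
  | succ w hvw ih =>
    by_cases h : a w = c
    · obtain ⟨t, h1, h2, h3⟩ := ih h
      exact ⟨t, h1, by omega, h3⟩
    · exact ⟨w, hvw, by omega, by rw [hw]; exact h, hw⟩

/-- Each `c` in `G` is the target of some switch, and switches with different targets are different.
-/
lemma card_le_switchesIn {k : ℕ} (a : ℕ → Fin k) (x y : ℕ) (G : Finset (Fin k))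
    (hG : ∀ c ∈ G, ∃ v w, x ≤ v ∧ v ≤ w ∧ w ≤ y ∧ a v ≠ c ∧ a w = c) :
    G.card ≤ switchesIn a x y := by
  unfold switchesIn
  refine le_trans (Finset.card_le_card ?_) (Finset.card_image_le (f := fun t => a (t + 1)))
  intro c hc
  obtain ⟨v, w, h1, h2, h3, h4, h5⟩ := hG c hc
  obtain ⟨t, h6, h7, h8, h9⟩ := exists_switch_to a c h2 h4 h5
  simp only [Finset.mem_image, Finset.mem_filter, Finset.mem_Ico]
  exact ⟨t, ⟨⟨by omega, by omega⟩, h8⟩, h9⟩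

lemma switchesIn_of_forall_exists {k : ℕ} (a : ℕ → Fin k) (x y : ℕ)
    (h : ∀ c, ∃ u, x ≤ u ∧ u ≤ y ∧ a u = c) : k - 1 ≤ switchesIn a x y := by
  have := card_le_switchesIn a x y (Finset.univ.erase (a x)) (fun c hc => by
    obtain ⟨u, h1, h2, h3⟩ := h c
    exact ⟨x, u, le_rfl, h1, h2, (Finset.ne_of_mem_erase hc).symm, h3⟩)
  simpa [Finset.card_erase_of_mem] using this

lemma mul_le_switchesIn {k : ℕ} (a : ℕ → Fin k) (t : ℕ → ℕ) (ht : Monotone t) (n : ℕ)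
    (h : ∀ j < n, ∀ c, ∃ u, t j ≤ u ∧ u < t (j + 1) ∧ a u = c) :
    n * (k - 1) ≤ switchesIn a (t 0) (t n) := by
  induction n with
  | zero => simp
  | succ n ih =>
    rw [← switchesIn_add a (ht (Nat.zero_le n)) (ht (Nat.le_succ n)), Nat.succ_mul]
    refine add_le_add (ih fun j hj => h j (by omega)) (switchesIn_of_forall_exists a _ _ fun c => ?_)
    obtain ⟨u, h1, h2, h3⟩ := h n (by omega) c
    exact ⟨u, h1, h2.le, h3⟩

/-- Within a budget of `(m + 1) (k - 1)` switches, a policy that visits every action in each of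
`m + 1` consecutive blocks has to give up an action `i` afterwards, unless it exhausts its budget at
the first visit to `i` in the last block. -/
lemma unvisited_or_abandoned_or_exhausted {k : ℕ} (a : ℕ → Fin k) (t : ℕ → ℕ) (ht : Monotone t)
    (h0 : t 0 = 0) (m S T : ℕ) (hS : S ≤ (m + 1) * (k - 1)) (hk : 2 ≤ k)
    (hsw : switchesIn a 0 (T - 1) ≤ S) (i : Fin k) :
    (∃ j ≤ m, ∃ c, ∀ u, t j ≤ u → u < t (j + 1) → a u ≠ c) ∨
    (∀ u, t (m + 1) ≤ u → u < T → a u ≠ i) ∨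
    (∃ s, t m ≤ s ∧ s < t (m + 1) ∧ (∀ u, t m ≤ u → u < s → a u ≠ i) ∧ a s = i ∧
      S ≤ switchesIn a 0 s) := by
  classical
  by_contra! hcon
  obtain ⟨hA, ⟨u, hu1, hu2, hu3⟩, hC⟩ := hcon
  have hex := hA m le_rfl i
  obtain ⟨s, ⟨hs1, hs2, hs3⟩, hfind⟩ : ∃ s, (t m ≤ s ∧ s < t (m + 1) ∧ a s = i) ∧
      ∀ v < s, ¬(t m ≤ v ∧ v < t (m + 1) ∧ a v = i) :=
    ⟨Nat.find hex, Nat.find_spec hex, fun v hv => Nat.find_min hex hv⟩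
  have hmin : ∀ v, t m ≤ v → v < s → a v ≠ i := fun v hv1 hv2 hv3 =>
    hfind v hv2 ⟨hv1, by omega, hv3⟩
  have hlt := hC s hs1 hs2 hmin hs3
  have hpre : m * (k - 1) ≤ switchesIn a 0 (t m) := by
    have := mul_le_switchesIn a t ht m (fun j hj c => hA j hj.le c)
    rwa [h0] at this
  have hadd1 := switchesIn_add a (Nat.zero_le (t m)) hs1
  have hadd2 := switchesIn_add a (Nat.zero_le s) (show s ≤ u by omega)
  have hadd3 := switchesIn_add a (Nat.zero_le u) (show u ≤ T - 1 by omega)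
  -- `V` collects the actions played from `t m` to `s`. It is not everything: otherwise the budget
  -- would be spent by round `s`, contrary to `hlt`.
  set V := (Finset.Icc (t m) s).image a with hV
  have hiV : i ∈ V := Finset.mem_image.2 ⟨s, Finset.mem_Icc.2 ⟨hs1, le_rfl⟩, hs3⟩
  have hxV : a (t m) ∈ V := Finset.mem_image.2 ⟨t m, Finset.mem_Icc.2 ⟨le_rfl, hs1⟩, rfl⟩
  have hG1 := card_le_switchesIn a (t m) s (V.erase (a (t m))) (fun c hc => by
    obtain ⟨hc1, hc2⟩ := Finset.mem_erase.1 hc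
    obtain ⟨w, hw, hwc⟩ := Finset.mem_image.1 hc2
    obtain ⟨hw1, hw2⟩ := Finset.mem_Icc.1 hw
    exact ⟨t m, w, le_rfl, hw1, hw2, hc1.symm, hwc⟩)
  rw [Finset.card_erase_of_mem hxV] at hG1
  have hVpos : 1 ≤ V.card := Finset.card_pos.2 ⟨_, hiV⟩
  have hVk : V.card ≤ k := by simpa using Finset.card_le_univ V
  have hmk : (m + 1) * (k - 1) = m * (k - 1) + (k - 1) := by ring
  have hVlt : V.card < k := by
    by_contra hge
    omega
  have hlate : ∀ c ∉ V, ∃ w, s ≤ w ∧ w ≤ u ∧ a w = c := fun c hc => by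
    obtain ⟨w, hw1, hw2, hw3⟩ := hA m le_rfl c
    refine ⟨w, ?_, by omega, hw3⟩
    by_contra hws
    exact hc (Finset.mem_image.2 ⟨w, Finset.mem_Icc.2 ⟨hw1, by omega⟩, hw3⟩)
  -- After `s` the actions outside `V` must still be entered, and `i` must be re-entered to be
  -- played at `u`, since some action outside `V` comes in between. With the earlier switches this
  -- totals at least `m (k - 1) + (|V| - 1) + (k - |V| + 1) > S`.
  have hG2 := card_le_switchesIn a s u (insert i Vᶜ) (fun c hc => by
    rcases Finset.mem_insert.1 hc with rfl | hc
    · obtain ⟨d, hd⟩ : (Vᶜ : Finset (Fin k)).Nonempty := by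
        rw [← Finset.card_pos, Finset.card_compl, Fintype.card_fin]; omega
      have hd' := Finset.mem_compl.1 hd
      obtain ⟨w, hw1, hw2, hw3⟩ := hlate d hd'
      refine ⟨w, u, hw1, hw2, le_rfl, ?_, hu3⟩
      rintro h
      rw [h] at hw3
      exact hd' (hw3 ▸ hiV)
    · have hc' := Finset.mem_compl.1 hc
      obtain ⟨w, hw1, hw2, hw3⟩ := hlate c hc'
      refine ⟨s, w, le_rfl, hw1, hw2, ?_, hw3⟩
      intro h
      exact hc' (h ▸ hs3 ▸ hiV))
  rw [Finset.card_insert_of_notMem (by simpa using hiV), Finset.card_compl, Fintype.card_fin] at hG2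
  omega

lemma eq_of_switchesIn_le {k : ℕ} (a : ℕ → Fin k) {s n S : ℕ} (h1 : S ≤ switchesIn a 0 s)
    (h2 : switchesIn a 0 n ≤ S) {u : ℕ} (hsu : s ≤ u) (hun : u ≤ n) : a u = a s := by
  by_contra hne
  obtain ⟨t, ht1, ht2, ht3, -⟩ := exists_switch_to a (a u) hsu (fun h => hne h.symm) rfl
  have hadd := switchesIn_add a (Nat.zero_le s) (hsu.trans hun)
  have : 0 < switchesIn a s n := Finset.card_pos.2
    ⟨t, Finset.mem_filter.2 ⟨Finset.mem_Ico.2 ⟨ht1, by omega⟩, ht3⟩⟩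
  omega

lemma switchesIn_congr {k : ℕ} {a b : ℕ → Fin k} {x y : ℕ} (h : ∀ u, u ≤ y → a u = b u) :
    switchesIn a x y = switchesIn b x y := by
  unfold switchesIn
  congr 1
  refine Finset.filter_congr fun t ht => ?_
  have := (Finset.mem_Ico.1 ht).2
  rw [h t (by omega), h (t + 1) (by omega)]

/-! ### Histories as action sequences -/

/-- The actions of a history, continued by the constant action `i`. -/
def History.actions {k n : ℕ} (i : Fin k) (h : History k n) (u : ℕ) : Fin k :=
  if hu : u < n then (h ⟨u, hu⟩).1 else i

lemma History.actions_of_lt {k n : ℕ} (i : Fin k) (h : History k n) {u : ℕ} (hu : u < n) :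
    h.actions i u = (h ⟨u, hu⟩).1 := dif_pos hu

lemma numSwitches_eq {k T : ℕ} (i : Fin k) (h : History k T) :
    numSwitches h = switchesIn (h.actions i) 0 (T - 1) := by
  unfold numSwitches switchesIn
  rw [Finset.card_filter, Nat.Ico_zero_eq_range, Finset.sum_range]
  refine Finset.sum_congr rfl fun t _ => ?_
  have := t.2
  rw [History.actions_of_lt i h (show (t : ℕ) < T by omega),
    History.actions_of_lt i h (show (t : ℕ) + 1 < T by omega)]
  by_cases hh : (h ⟨t, by omega⟩).1 = (h ⟨t + 1, by omega⟩).1 <;> simp [hh]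

lemma measurableSet_of_actions {k n : ℕ} (i : Fin k) (P : (ℕ → Fin k) → Prop) :
    MeasurableSet {h : History k n | P (h.actions i)} := by
  have hm : Measurable (fun (h : History k n) (u : Fin n) => (h u).1) :=
    measurable_pi_lambda _ fun u => measurable_fst.comp (measurable_pi_apply u)
  exact hm (Set.toFinite
    {b : Fin n → Fin k | P (fun u => if hu : u < n then b ⟨u, hu⟩ else i)}).measurableSet

/-! ### Change of measure -/

open scoped ENNReal

lemma lintegral_rpow_le_rpow_lintegral {α : Type*} [MeasurableSpace α] (μ : Measure α)
    [IsProbabilityMeasure μ] {f : α → ℝ≥0∞} (hf : Measurable f) :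
    ∫⁻ x, f x ^ (2 / 3 : ℝ) ∂μ ≤ (∫⁻ x, f x ∂μ) ^ (2 / 3 : ℝ) := by
  have hpq : (3 / 2 : ℝ).HolderConjugate 3 := by
    rw [Real.holderConjugate_iff]; norm_num
  have h := ENNReal.lintegral_mul_le_Lp_mul_Lq μ hpq
    (f := fun x => f x ^ (2 / 3 : ℝ)) (g := fun _ => 1) (by fun_prop) (by fun_prop)
  simp only [Pi.mul_apply, mul_one, ← ENNReal.rpow_mul] at h
  norm_num at h
  simpa using h

/-- The function `f` of the history depends on the history only up to the first round `≥ t` at which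
action `i` is chosen (the reward of that round excluded). -/
def StoppedAt {k n : ℕ} (t : ℕ) (i : Fin k) (f : History k n → ℝ≥0∞) : Prop :=
  ∀ s : Fin n, t ≤ s → ∀ h h' : History k n, (∀ u < s, h u = h' u) → (h s).1 = i →
    (h' s).1 = i → f h = f h'

lemma lintegral_law_succ {k : ℕ} (π : Policy k) (D : Env k) (n : ℕ) {f : History k (n + 1) → ℝ≥0∞}
    (hf : Measurable f) :
    ∫⁻ h, f h ∂(law π D (n + 1)) =
      ∫⁻ h, ∫⁻ p, f (Fin.snoc h p : History k (n + 1)) ∂(stepKernel π D n h) ∂(law π D n) := by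
  rw [law, lintegral_map hf (measurable_snoc k n)]
  exact Measure.lintegral_compProd (hf.comp (measurable_snoc k n))

lemma lintegral_stepKernel {k : ℕ} (π : Policy k) (D : Env k) (n : ℕ) (h : History k n)
    {f : Fin k × ℝ → ℝ≥0∞} (hf : Measurable f) :
    ∫⁻ p, f p ∂(stepKernel π D n h) = ∫⁻ a, ∫⁻ x, f (a, x) ∂(D.dist a) ∂(π.act n h) := by
  rw [stepKernel, Kernel.lintegral_compProd _ _ _ hf]
  rfl

/-- The policy draws the action from the same law in both environments, so only the rewards
contribute the factor `c`; Jensen handles the draw of the action. -/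
lemma lintegral_stepKernel_rpow_le {k : ℕ} (π : Policy k) (D D' : Env k) (n : ℕ) (h : History k n)
    (c : ℝ≥0∞) {f : Fin k × ℝ → ℝ≥0∞} (hf : Measurable f)
    (hc : ∀ a, ∫⁻ x, f (a, x) ^ (2 / 3 : ℝ) ∂(D.dist a) ≤
      c * (∫⁻ x, f (a, x) ∂(D'.dist a)) ^ (2 / 3 : ℝ)) :
    ∫⁻ p, f p ^ (2 / 3 : ℝ) ∂(stepKernel π D n h) ≤
      c * (∫⁻ p, f p ∂(stepKernel π D' n h)) ^ (2 / 3 : ℝ) := by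
  rw [lintegral_stepKernel π D n h (hf.pow_const _), lintegral_stepKernel π D' n h hf]
  refine (lintegral_mono hc).trans ?_
  rw [lintegral_const_mul _ (measurable_of_countable _)]
  gcongr
  exact lintegral_rpow_le_rpow_lintegral _ (measurable_of_countable _)

/-- Change of measure between two environments that differ only in action `i`, for quantities that
do not use the rewards of that action from round `t` on. -/
theorem lintegral_law_rpow_le {k : ℕ} (π : Policy k) (D D' : Env k) (i : Fin k) (t : ℕ) (c : ℝ≥0∞)
    (hc : 1 ≤ c) (hne : ∀ a ≠ i, D.dist a = D'.dist a)
    (hi : ∀ f : ℝ → ℝ≥0∞, Measurable f → ∫⁻ x, f x ^ (2 / 3 : ℝ) ∂(D.dist i) ≤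
      c * (∫⁻ x, f x ∂(D'.dist i)) ^ (2 / 3 : ℝ)) (n : ℕ) :
    ∀ f : History k n → ℝ≥0∞, Measurable f → StoppedAt t i f →
      ∫⁻ h, f h ^ (2 / 3 : ℝ) ∂(law π D n) ≤
        c ^ (min n t) * (∫⁻ h, f h ∂(law π D' n)) ^ (2 / 3 : ℝ) := by
  induction n with
  | zero =>
    intro f hf _
    have : law π D 0 = law π D' 0 := rfl
    simpa [this] using lintegral_rpow_le_rpow_lintegral (law π D' 0) hf
  | succ n ih =>
    intro f hf hst
    have hfs := hf.comp (measurable_snoc k n)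
    have hfh : ∀ h : History k n,
        Measurable fun p : Fin k × ℝ => f (Fin.snoc h p : History k (n + 1)) := fun h =>
      hfs.comp (measurable_const.prodMk measurable_id)
    rw [lintegral_law_succ π D n (hf.pow_const _), lintegral_law_succ π D' n hf]
    -- The last round is averaged out under `D'`; the form `f ^ (2/3)` on the left and `(∫ f) ^
    -- (2/3)` on the right lets the induction close.
    set g : History k n → ℝ≥0∞ := fun h =>
      ∫⁻ p, f (Fin.snoc h p : History k (n + 1)) ∂(stepKernel π D' n h) with hg
    have hgm : Measurable g := hfs.lintegral_kernel_prod_right'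
    have hgst : StoppedAt t i g := by
      intro s hs h h' hag hi1 hi2
      have key : ∀ p q : Fin k × ℝ, f (Fin.snoc h p : History k (n + 1)) =
          f (Fin.snoc h' q : History k (n + 1)) := fun p q => by
        refine hst s.castSucc hs _ _ (fun u hu => ?_) ?_ ?_
        · have hu' : (u : ℕ) < s := hu
          have : u = (⟨u, by omega⟩ : Fin n).castSucc := rfl
          rw [this, Fin.snoc_castSucc, Fin.snoc_castSucc]
          exact hag _ hu'
        · rw [Fin.snoc_castSucc]; exact hi1
        · rw [Fin.snoc_castSucc]; exact hi2
      -- Action `i` has already been played at or after `t`, so `f` ignores the last round; `(i, 0)`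
      -- is a dummy outcome.
      have e1 : g h = f (Fin.snoc h (i, 0) : History k (n + 1)) := by
        simp only [hg]
        rw [lintegral_congr fun p => (key p (i, 0)).trans (key (i, 0) (i, 0)).symm]
        simp
      have e2 : g h' = f (Fin.snoc h' (i, 0) : History k (n + 1)) := by
        simp only [hg]
        rw [lintegral_congr fun p => (key (i, 0) p).symm.trans (key (i, 0) (i, 0))]
        simp
      rw [e1, e2, key]
    have hstep : ∀ h : History k n,
        ∫⁻ p, f (Fin.snoc h p : History k (n + 1)) ^ (2 / 3 : ℝ) ∂(stepKernel π D n h) ≤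
          (if n < t then c else 1) * g h ^ (2 / 3 : ℝ) := by
      intro h
      refine lintegral_stepKernel_rpow_le π D D' n h _ (hfh h) fun a => ?_
      have hfa : Measurable fun x => f (Fin.snoc h (a, x) : History k (n + 1)) :=
        (hfh h).comp (measurable_const.prodMk measurable_id)
      have := D'.isProb a
      by_cases ha : a = i
      · subst ha
        split_ifs with hnt
        · exact hi _ hfa
        -- From round `t` on, `f` ignores the reward of `i`, so no factor `c` is paid.
        · have key : ∀ x : ℝ, f (Fin.snoc h (a, x) : History k (n + 1)) =
              f (Fin.snoc h (a, 0) : History k (n + 1)) := fun x => by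
            refine hst (Fin.last n) (by simpa using hnt) _ _ (fun u hu => ?_) ?_ ?_
            · have hu' : (u : ℕ) < n := hu
              have : u = (⟨u, hu'⟩ : Fin n).castSucc := rfl
              rw [this, Fin.snoc_castSucc, Fin.snoc_castSucc]
            · simp
            · simp
          have := D.isProb a
          simp [key]
      · rw [hne a ha]
        refine (lintegral_rpow_le_rpow_lintegral _ hfa).trans ?_
        refine le_mul_of_one_le_left zero_le ?_
        split_ifs
        exacts [hc, le_rfl]
    refine (lintegral_mono hstep).trans ?_
    rw [lintegral_const_mul _ (hgm.pow_const _)]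
    refine (mul_le_mul_right (ih g hgm hgst) _).trans ?_
    rw [← mul_assoc]
    gcongr
    split_ifs with hnt
    · rw [min_eq_left hnt.le, min_eq_left (show n + 1 ≤ t from hnt), pow_succ, mul_comm]
    · rw [min_eq_right (by omega), min_eq_right (by omega), one_mul]

/-! ### Environments with rewards ±1 -/

/-- The distribution on `{-1, 1}` with mean `x`. -/
noncomputable def signMeasure (x : ℝ) : Measure ℝ :=
  ENNReal.ofReal ((1 + x) / 2) • Measure.dirac 1 + ENNReal.ofReal ((1 - x) / 2) • Measure.dirac (-1)

lemma lintegral_signMeasure (x : ℝ) (f : ℝ → ℝ≥0∞) :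
    ∫⁻ z, f z ∂(signMeasure x) =
      ENNReal.ofReal ((1 + x) / 2) * f 1 + ENNReal.ofReal ((1 - x) / 2) * f (-1) := by
  simp [signMeasure]

lemma isProbabilityMeasure_signMeasure {x : ℝ} (hx : x ∈ Set.Icc (0 : ℝ) (1 / 2)) :
    IsProbabilityMeasure (signMeasure x) := by
  refine ⟨?_⟩
  rw [← lintegral_one, lintegral_signMeasure, mul_one, mul_one, ← ENNReal.ofReal_add]
  · ring_nf; simp
  · linarith [hx.1]
  · linarith [hx.2]

lemma integral_signMeasure {x : ℝ} (hx : x ∈ Set.Icc (0 : ℝ) (1 / 2)) :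
    ∫ z, z ∂(signMeasure x) = x := by
  rw [signMeasure, integral_add_measure, integral_smul_measure, integral_smul_measure,
    integral_dirac, integral_dirac, ENNReal.toReal_ofReal, ENNReal.toReal_ofReal]
  · simp only [smul_eq_mul]; ring
  · linarith [hx.2]
  · linarith [hx.1]
  · exact (integrable_dirac (by simp)).smul_measure ENNReal.ofReal_ne_top
  · exact (integrable_dirac (by simp)).smul_measure ENNReal.ofReal_ne_top

lemma ae_mem_Icc_signMeasure (x : ℝ) : ∀ᵐ z ∂(signMeasure x), z ∈ Set.Icc (-1 : ℝ) 1 := by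
  rw [signMeasure, ae_add_measure_iff]
  constructor
  · exact Measure.ae_smul_measure (by rw [ae_dirac_eq]; simp) _
  · exact Measure.ae_smul_measure (by rw [ae_dirac_eq]; simp) _

/-- The environment with rewards in `{-1, 1}` and mean rewards `μ`. -/
noncomputable def signEnv {k : ℕ} (μ : Fin k → ℝ) (hμ : ∀ i, μ i ∈ Set.Icc (0 : ℝ) (1 / 2)) :
    Env k where
  dist i := signMeasure (μ i)
  isProb i := isProbabilityMeasure_signMeasure (hμ i)
  subGaussian i := by
    have := isProbabilityMeasure_signMeasure (hμ i)
    -- Hoeffding's lemma on an interval of length `2` gives variance proxy exactly `1`.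
    have h := hasSubgaussianMGF_of_mem_Icc (X := fun z : ℝ => z) aemeasurable_id
      (ae_mem_Icc_signMeasure (μ i))
    have e : (‖(1 : ℝ) - -1‖₊ / 2) ^ 2 = 1 := by
      ext; push_cast; norm_num
    rwa [e] at h
  spread_le_one i j := by
    rw [integral_signMeasure (hμ i), integral_signMeasure (hμ j), abs_le]
    constructor <;> linarith [(hμ i).1, (hμ i).2, (hμ j).1, (hμ j).2]

lemma mean_signEnv {k : ℕ} (μ : Fin k → ℝ) (hμ : ∀ i, μ i ∈ Set.Icc (0 : ℝ) (1 / 2)) (i : Fin k) :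
    (signEnv μ hμ).mean i = μ i := integral_signMeasure (hμ i)

/-- The left side is the third moment of the likelihood ratio. Since the ratio has mean `1`, the
first-order term in `x - y` vanishes. -/
lemma cube_moment_le {x y : ℝ} (hx : x ∈ Set.Icc (0 : ℝ) (1 / 2))
    (hy : y ∈ Set.Icc (0 : ℝ) (1 / 2)) :
    (1 + y) / 2 * ((1 + x) / (1 + y)) ^ 3 + (1 - y) / 2 * ((1 - x) / (1 - y)) ^ 3 ≤
      1 + 6 * (x - y) ^ 2 := by
  obtain ⟨hx0, hx1⟩ := hx
  obtain ⟨hy0, hy1⟩ := hy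
  have h1 : 1 + y ≠ 0 := by linarith
  have h2 : 1 - y ≠ 0 := by linarith
  have hq : 3 / 4 ≤ 1 - y ^ 2 := by nlinarith
  have h3 : 1 - y ^ 2 ≠ 0 := by linarith
  have e : (1 + y) / 2 * ((1 + x) / (1 + y)) ^ 3 + (1 - y) / 2 * ((1 - x) / (1 - y)) ^ 3 =
      1 + (x - y) ^ 2 * ((3 * (1 - y ^ 2) - 2 * y * (x - y)) / (1 - y ^ 2) ^ 2) := by
    have h4 : 1 - y ^ 2 = (1 + y) * (1 - y) := by ring
    rw [h4]
    field_simp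
    ring
  rw [e]
  -- The numerator equals `3 - y² - 2xy ≤ 3`, and the denominator is at least `9/16`.
  have : (3 * (1 - y ^ 2) - 2 * y * (x - y)) / (1 - y ^ 2) ^ 2 ≤ 6 := by
    rw [div_le_iff₀ (by positivity)]
    nlinarith [mul_nonneg hy0 hx0]
  nlinarith [sq_nonneg (x - y)]

/-- A Hölder inequality between two distributions on `{-1, 1}`. -/
lemma lintegral_signMeasure_rpow_le {x y : ℝ} (hx : x ∈ Set.Icc (0 : ℝ) (1 / 2))
    (hy : y ∈ Set.Icc (0 : ℝ) (1 / 2)) {f : ℝ → ℝ≥0∞} (hf : Measurable f) :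
    ∫⁻ z, f z ^ (2 / 3 : ℝ) ∂(signMeasure x) ≤
      ENNReal.ofReal (Real.exp (2 * (x - y) ^ 2)) *
        (∫⁻ z, f z ∂(signMeasure y)) ^ (2 / 3 : ℝ) := by
  have hpq : (3 / 2 : ℝ).HolderConjugate 3 := by
    rw [Real.holderConjugate_iff]; norm_num
  obtain ⟨hx0, hx1⟩ := id hx
  obtain ⟨hy0, hy1⟩ := id hy
  -- The likelihood ratio of `signMeasure x` to `signMeasure y`.
  set l : ℝ → ℝ≥0∞ := fun z =>
    if z = 1 then ENNReal.ofReal ((1 + x) / (1 + y)) else ENNReal.ofReal ((1 - x) / (1 - y)) with hl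
  have hlm : Measurable l :=
    Measurable.ite (measurableSet_singleton 1) measurable_const measurable_const
  have hl1 : l 1 = ENNReal.ofReal ((1 + x) / (1 + y)) := by simp [hl]
  have hl2 : l (-1) = ENNReal.ofReal ((1 - x) / (1 - y)) := by norm_num [hl]
  have h := ENNReal.lintegral_mul_le_Lp_mul_Lq (signMeasure y) hpq
    (f := fun z => f z ^ (2 / 3 : ℝ)) (g := l) (hf.pow_const _).aemeasurable hlm.aemeasurable
  have e1 : ∫⁻ z, ((fun z => f z ^ (2 / 3 : ℝ)) * l) z ∂(signMeasure y) =
      ∫⁻ z, f z ^ (2 / 3 : ℝ) ∂(signMeasure x) := by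
    rw [lintegral_signMeasure, lintegral_signMeasure]
    simp only [Pi.mul_apply, hl1, hl2]
    rw [mul_comm (f 1 ^ _), mul_comm (f (-1) ^ _), ← mul_assoc, ← mul_assoc,
      ← ENNReal.ofReal_mul (by linarith), ← ENNReal.ofReal_mul (by linarith)]
    have h1 : 1 + y ≠ 0 := by linarith
    have h2 : 1 - y ≠ 0 := by linarith
    congr 3 <;> field_simp
  have e2 : ∫⁻ z, l z ^ (3 : ℝ) ∂(signMeasure y) ≤
      ENNReal.ofReal (Real.exp (6 * (x - y) ^ 2)) := by
    have hp1 : 0 ≤ (1 + x) / (1 + y) := div_nonneg (by linarith) (by linarith)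
    have hp2 : 0 ≤ (1 - x) / (1 - y) := div_nonneg (by linarith) (by linarith)
    rw [lintegral_signMeasure, hl1, hl2, show (3 : ℝ) = ((3 : ℕ) : ℝ) by norm_num,
      ENNReal.rpow_natCast, ENNReal.rpow_natCast,
      ← ENNReal.ofReal_pow hp1, ← ENNReal.ofReal_pow hp2,
      ← ENNReal.ofReal_mul (by linarith), ← ENNReal.ofReal_mul (by linarith),
      ← ENNReal.ofReal_add (mul_nonneg (by linarith) (pow_nonneg hp1 _))
        (mul_nonneg (by linarith) (pow_nonneg hp2 _))]
    refine ENNReal.ofReal_le_ofReal ((cube_moment_le hx hy).trans ?_)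
    linarith [Real.add_one_le_exp (6 * (x - y) ^ 2)]
  have e3 : ENNReal.ofReal (Real.exp (6 * (x - y) ^ 2)) ^ (1 / 3 : ℝ) =
      ENNReal.ofReal (Real.exp (2 * (x - y) ^ 2)) := by
    rw [ENNReal.ofReal_rpow_of_pos (Real.exp_pos _), ← Real.exp_mul]
    ring_nf
  rw [e1] at h
  simp only [← ENNReal.rpow_mul] at h
  rw [← e3, mul_comm]
  refine h.trans ?_
  norm_num
  gcongr
  simpa using e2

/-! ### From avoided rounds to regret -/

lemma Env.gap_le {k : ℕ} (D : Env k) {i j : Fin k} (hji : j ≠ i) :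
    D.gap i ≤ |D.mean i - D.mean j| :=
  ciInf_le (f := fun j : {j : Fin k // j ≠ i} => |D.mean i - D.mean j|)
    (Set.finite_range _).bddBelow ⟨j, hji⟩

lemma Env.le_gap {k : ℕ} (D : Env k) {i j : Fin k} (hji : j ≠ i) {g : ℝ}
    (hg : ∀ a ≠ i, D.mean a + g ≤ D.mean i) : g ≤ D.gap i := by
  have : Nonempty {j : Fin k // j ≠ i} := ⟨⟨j, hji⟩⟩
  exact le_ciInf fun a => le_trans (by linarith [hg a a.2]) (le_abs_self _)

lemma Env.IsOptimal.iSup_mean {k : ℕ} {D : Env k} {i : Fin k} (hi : D.IsOptimal i) :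
    ⨆ j, D.mean j = D.mean i := by
  have : Nonempty (Fin k) := ⟨i⟩
  exact le_antisymm (ciSup_le hi) (le_ciSup (Set.finite_range D.mean).bddAbove i)

/-- Each round in which the optimal action is not chosen costs at least the gap. -/
lemma gap_mul_le_regret {k T : ℕ} (π : Policy k) (D : Env k) {i : Fin k} (hi : D.IsOptimal i)
    {E : Set (History k T)} (hE : MeasurableSet E) (N : ℕ)
    (hN : ∀ᵐ h ∂(law π D T), h ∈ E → N ≤ (Finset.univ.filter fun t => (h t).1 ≠ i).card) :
    D.gap i * N * (law π D T).real E ≤ regret π D T := by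
  have hgap0 : 0 ≤ D.gap i := Real.iInf_nonneg fun _ => abs_nonneg _
  have hint : Integrable (fun h : History k T => ∑ t, D.mean (h t).1) (law π D T) := by
    refine integrable_finsetSum _ fun t _ => ?_
    obtain ⟨B, hB⟩ := (Set.finite_range fun a => ‖D.mean a‖).bddAbove
    exact Integrable.of_bound
      ((measurable_of_countable D.mean).comp
        (measurable_fst.comp (measurable_pi_apply t))).aestronglyMeasurable B
      (ae_of_all _ fun h => hB ⟨_, rfl⟩)
  have hint2 : Integrable (fun h : History k T =>
      T * D.mean i - D.gap i * N * E.indicator (fun _ => (1 : ℝ)) h) (law π D T) :=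
    (integrable_const _).sub (((integrable_const 1).indicator hE).const_mul _)
  have hle : ∫ h, ∑ t, D.mean (h t).1 ∂(law π D T) ≤
      ∫ h, (T * D.mean i - D.gap i * N * E.indicator (fun _ => (1 : ℝ)) h) ∂(law π D T) := by
    refine integral_mono_ae hint hint2 ?_
    filter_upwards [hN] with h hh
    have hterm : ∀ t : Fin T, D.mean (h t).1 ≤
        D.mean i - D.gap i * (if (h t).1 ≠ i then 1 else 0) := by
      intro t
      split_ifs with ht
      · have := D.gap_le ht
        rw [abs_of_nonneg (by linarith [hi (h t).1])] at this
        linarith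
      · simpa using hi (h t).1
    refine (Finset.sum_le_sum fun t _ => hterm t).trans ?_
    rw [Finset.sum_sub_distrib, ← Finset.mul_sum, Finset.sum_boole]
    simp only [Finset.sum_const, Finset.card_univ, Fintype.card_fin, nsmul_eq_mul]
    refine sub_le_sub_left ?_ _
    rw [mul_assoc]
    refine mul_le_mul_of_nonneg_left ?_ hgap0
    by_cases hhE : h ∈ E
    · simpa [hhE] using hh hhE
    · simp [hhE]
  rw [integral_sub (integrable_const _) (((integrable_const 1).indicator hE).const_mul _),
    integral_const, integral_const_mul (D.gap i * N), integral_indicator hE] at hle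
  simp only [integral_const, probReal_univ, smul_eq_mul, mul_one,
    measureReal_restrict_apply_univ] at hle
  rw [regret, hi.iSup_mean]
  linarith

lemma sub_le_card_ne {k T : ℕ} (h : History k T) (i j : Fin k) {x y : ℕ} (hyT : y ≤ T)
    (hne : ∀ u, x ≤ u → u < y → h.actions j u ≠ i) :
    y - x ≤ (Finset.univ.filter fun t => (h t).1 ≠ i).card := by
  rw [← Nat.card_Ico, ← Finset.card_attach]
  refine Finset.card_le_card_of_injOn
    (fun u => ⟨u.1, lt_of_lt_of_le (Finset.mem_Ico.1 u.2).2 hyT⟩) ?_ ?_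
  · intro u _
    obtain ⟨h1, h2⟩ := Finset.mem_Ico.1 u.2
    have := hne u.1 h1 h2
    rw [History.actions_of_lt j h (by omega)] at this
    simpa using this
  · intro u _ v _ huv
    exact Subtype.ext (by simpa using huv)

/-- The gap enters twice, as the factor `Δ` and as the regret per round, hence `g ^ 2`. Avoidance is
only required almost surely, so that the switch budget can be used in `D`. -/
lemma le_iSup_gap_mul_regret {k T : ℕ} (π : Policy k) (D : Env k) {i i' : Fin k} (hi' : i' ≠ i)
    {g : ℝ} (hg : 0 < g) (hmean : ∀ a ≠ i, D.mean a + g ≤ D.mean i)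
    {E : Set (History k T)} (hE : MeasurableSet E) (j : Fin k) {x y : ℕ} (hxy : x ≤ y) (hyT : y ≤ T)
    (hav : ∀ᵐ h ∂(law π D T), h ∈ E → ∀ u, x ≤ u → u < y → h.actions j u ≠ i)
    {B : ℝ} (hB : B ≤ g ^ 2 * ((y : ℝ) - x) * (law π D T).real E) :
    (B : EReal) ≤ ⨆ (D : Env k) (i : Fin k) (_ : D.IsOptimal i)
      (_ : D.gap i ∈ Set.Ioc (0 : ℝ) 1), ((D.gap i * regret π D T : ℝ) : EReal) := by
  have hopt : D.IsOptimal i := fun a => by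
    by_cases ha : a = i
    · rw [ha]
    · linarith [hmean a ha]
  have hgap := D.le_gap hi' hmean
  have hreg := gap_mul_le_regret π D hopt hE (y - x) (by
    filter_upwards [hav] with h hh hhE
    exact sub_le_card_ne h i j hyT (hh hhE))
  rw [Nat.cast_sub hxy] at hreg
  have hxy' : (0 : ℝ) ≤ (y : ℝ) - x := sub_nonneg.2 (by exact_mod_cast hxy)
  refine le_trans ?_ (le_iSup_of_le D (le_iSup_of_le i (le_iSup_of_le hopt
    (le_iSup_of_le ⟨hg.trans_le hgap, (D.gap_le hi').trans (D.spread_le_one _ _)⟩ le_rfl))))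
  rw [EReal.coe_le_coe_iff]
  calc B ≤ g ^ 2 * ((y : ℝ) - x) * (law π D T).real E := hB
    _ ≤ D.gap i ^ 2 * ((y : ℝ) - x) * (law π D T).real E := by gcongr
    _ = D.gap i * (D.gap i * ((y : ℝ) - x) * (law π D T).real E) := by ring
    _ ≤ _ := mul_le_mul_of_nonneg_left hreg (hg.le.trans hgap)

/-! ### Pigeonhole, transfer and the bound for a general schedule -/

lemma exists_le_measureReal {Ω ι : Type*} [MeasurableSpace Ω] [Fintype ι] (μ : Measure Ω)
    [IsProbabilityMeasure μ] (E : ι → Set Ω) (h : ∀ᵐ ω ∂μ, ∃ i, ω ∈ E i) {p : ℝ}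
    (hp : p * Fintype.card ι ≤ 1) : ∃ i, p ≤ μ.real (E i) := by
  by_contra! hlt
  have h1 : μ.real (⋃ i, E i) = 1 := by
    rw [← probReal_univ (μ := μ)]
    refine measureReal_congr ?_
    filter_upwards [h] with ω hω
    exact propext ⟨fun _ => trivial, fun _ => Set.mem_iUnion.2 hω⟩
  have h2 := measureReal_iUnion_fintype_le (μ := μ) E
  rcases isEmpty_or_nonempty ι with hι | hι
  · simp at h1
  · have h3 : ∑ i, μ.real (E i) < ∑ _i : ι, p :=
      Finset.sum_lt_sum_of_nonempty Finset.univ_nonempty fun i _ => hlt i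
    simp only [Finset.sum_const, Finset.card_univ, nsmul_eq_mul] at h3
    linarith

lemma stoppedAt_indicator {k n t : ℕ} {i : Fin k} (P : (ℕ → Fin k) → Prop)
    (hP : ∀ s, t ≤ s → ∀ a b : ℕ → Fin k, (∀ u < s, a u = b u) → a s = i → b s = i → P a → P b) :
    StoppedAt t i ({h : History k n | P (h.actions i)}.indicator fun _ => (1 : ℝ≥0∞)) := by
  intro s hs h h' hag h1 h2
  have key : ∀ g g' : History k n, (∀ u < s, g u = g' u) → (g s).1 = i → (g' s).1 = i →
      P (g.actions i) → P (g'.actions i) := by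
    intro g g' hag h1 h2
    refine hP s hs _ _ (fun u hu => ?_) ?_ ?_
    · have hun : u < n := hu.trans s.2
      rw [History.actions_of_lt i g hun, History.actions_of_lt i g' hun, hag ⟨u, hun⟩ hu]
    · rw [History.actions_of_lt i g s.2]; exact h1
    · rw [History.actions_of_lt i g' s.2]; exact h2
  have : P (h.actions i) ↔ P (h'.actions i) :=
    ⟨key h h' hag h1 h2, key h' h (fun u hu => (hag u hu).symm) h2 h1⟩
  by_cases hh : P (h.actions i)
  · simp [Set.indicator, hh, this.1 hh]
  · simp [Set.indicator, hh, mt this.2 hh]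

/-- Transfer of a lower bound for the probability of an event to an environment in which the mean
of one action is different. -/
lemma le_law_real_signEnv {k n t : ℕ} (π : Policy k) {μ ν : Fin k → ℝ}
    (hμ : ∀ i, μ i ∈ Set.Icc (0 : ℝ) (1 / 2)) (hν : ∀ i, ν i ∈ Set.Icc (0 : ℝ) (1 / 2)) (i : Fin k)
    (hne : ∀ a ≠ i, μ a = ν a) {E : Set (History k n)} (hE : MeasurableSet E)
    (hst : StoppedAt t i (E.indicator fun _ => (1 : ℝ≥0∞)))
    (ht : 2 * (μ i - ν i) ^ 2 * t ≤ 1) {p : ℝ} (hp0 : 0 ≤ p)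
    (hp : p ≤ (law π (signEnv μ hμ) n).real E) :
    (p * Real.exp (-1)) ^ (3 / 2 : ℝ) ≤ (law π (signEnv ν hν) n).real E := by
  set D := signEnv μ hμ
  set D' := signEnv ν hν
  have h := lintegral_law_rpow_le π D D' i t (ENNReal.ofReal (Real.exp (2 * (μ i - ν i) ^ 2)))
    (by rw [ENNReal.one_le_ofReal]; exact Real.one_le_exp (by positivity))
    (fun a ha => by
      change signMeasure (μ a) = signMeasure (ν a)
      rw [hne a ha])
    (fun f hf => lintegral_signMeasure_rpow_le (hμ i) (hν i) hf) n
    (E.indicator fun _ => 1) (measurable_const.indicator hE) hst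
  have e1 : ∀ x, (E.indicator (fun _ => (1 : ℝ≥0∞)) x) ^ (2 / 3 : ℝ) =
      E.indicator (fun _ => (1 : ℝ≥0∞)) x := fun x => by
    by_cases hx : x ∈ E <;> simp [hx]
  simp only [e1, lintegral_indicator_const hE, one_mul] at h
  have h2 := ENNReal.toReal_mono (by finiteness) h
  rw [ENNReal.toReal_mul, ENNReal.toReal_pow, ← ENNReal.toReal_rpow,
    ENNReal.toReal_ofReal (Real.exp_pos _).le] at h2
  change (law π D n).real E ≤ _ * (law π D' n).real E ^ (2 / 3 : ℝ) at h2
  have h3 : Real.exp (2 * (μ i - ν i) ^ 2) ^ min n t ≤ Real.exp 1 := by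
    rw [← Real.exp_nat_mul, Real.exp_le_exp, mul_comm]
    refine le_trans ?_ ht
    have : ((min n t : ℕ) : ℝ) ≤ t := by exact_mod_cast min_le_right n t
    gcongr
  have h4 : p * Real.exp (-1) ≤ (law π D' n).real E ^ (2 / 3 : ℝ) := by
    have : p ≤ Real.exp 1 * (law π D' n).real E ^ (2 / 3 : ℝ) :=
      hp.trans (h2.trans (by gcongr))
    calc p * Real.exp (-1) ≤ Real.exp 1 * (law π D' n).real E ^ (2 / 3 : ℝ) * Real.exp (-1) := by
          gcongr
      _ = (law π D' n).real E ^ (2 / 3 : ℝ) := by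
          rw [mul_right_comm, ← Real.exp_add]; simp
  calc (p * Real.exp (-1)) ^ (3 / 2 : ℝ)
      ≤ ((law π D' n).real E ^ (2 / 3 : ℝ)) ^ (3 / 2 : ℝ) :=
        Real.rpow_le_rpow (by positivity) h4 (by norm_num)
    _ = (law π D' n).real E := by
        rw [← Real.rpow_mul (by positivity)]; norm_num

/-- The lower bound for an arbitrary schedule `t` of blocks and gaps `δ`. -/
lemma le_iSup_of_schedule {k m S T : ℕ} (hk : 2 ≤ k) (hT : 1 ≤ T) (hS : S ≤ (m + 1) * (k - 1))
    (π : Policy k) (hπ : IsSwitchPolicy S T π) (t : ℕ → ℕ) (ht : Monotone t) (h0 : t 0 = 0)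
    (htT : t (m + 1) ≤ T) (δ : ℕ → ℝ) (hδ0 : ∀ j, 0 < δ j) (hδ1 : ∀ j, δ j ≤ 1 / 16)
    (hδm : ∀ j ≤ m, δ m ≤ δ j) (hδt : ∀ j ≤ m, δ j ^ 2 * t j ≤ 1 / 18) {L : ℝ} (hL : 0 ≤ L)
    (hLj : ∀ j ≤ m, L ≤ δ j ^ 2 * ((t (j + 1) : ℝ) - t j))
    (hLm : L ≤ δ m ^ 2 * ((T : ℝ) - t (m + 1))) :
    ((L * ((1 / (2 * k * (m + 1)) : ℝ) * Real.exp (-1)) ^ (3 / 2 : ℝ) : ℝ) : EReal) ≤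
      ⨆ (D : Env k) (i : Fin k) (_ : D.IsOptimal i)
        (_ : D.gap i ∈ Set.Ioc (0 : ℝ) 1), ((D.gap i * regret π D T : ℝ) : EReal) := by
  classical
  set i₁ : Fin k := ⟨0, by omega⟩ with hi₁
  set i₂ : Fin k := ⟨1, by omega⟩ with hi₂
  have h12 : i₁ ≠ i₂ := by simp [hi₁, hi₂]
  set p : ℝ := 1 / (2 * k * (m + 1)) with hp
  have hkR : (2 : ℝ) ≤ k := by exact_mod_cast hk
  have hmR : (0 : ℝ) ≤ m := Nat.cast_nonneg m
  have hp0 : 0 < p := by positivity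
  have hp1 : p ≤ 1 := by
    rw [hp, div_le_one (by positivity)]
    nlinarith
  set q : ℝ := (p * Real.exp (-1)) ^ (3 / 2 : ℝ) with hq
  have hexp1 : Real.exp (-1) ≤ 1 := Real.exp_le_one_iff.2 (by norm_num)
  have hqp : q ≤ p := by
    have h1 : p * Real.exp (-1) ≤ 1 := mul_le_one₀ hp1 (Real.exp_pos _).le hexp1
    calc q ≤ (p * Real.exp (-1)) ^ (1 : ℝ) :=
          Real.rpow_le_rpow_of_exponent_ge (by positivity) h1 (by norm_num)
      _ = p * Real.exp (-1) := Real.rpow_one _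
      _ ≤ p := mul_le_of_le_one_right hp0.le hexp1
  set d := δ m with hd
  have hd0 : 0 < d := hδ0 m
  have hd1 : d ≤ 1 / 16 := hδ1 m
  -- The middle value `d` at `i₂` provides a unique optimum with gap `d` once `i₁` is lowered to
  -- `0`.
  set μ : Fin k → ℝ := fun a => if a = i₁ then 2 * d else if a = i₂ then d else 0 with hμdef
  have hμ1 : μ i₁ = 2 * d := by simp [hμdef]
  have hμ2 : μ i₂ = d := by simp [hμdef, h12.symm]
  have hμlow : ∀ a, 0 ≤ μ a := fun a => by
    simp only [hμdef]; split_ifs <;> linarith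
  have hμhigh : ∀ a, μ a ≤ 2 * d := fun a => by
    simp only [hμdef]; split_ifs <;> linarith
  have hμne : ∀ a ≠ i₁, μ a ≤ d := fun a ha => by
    simp only [hμdef, if_neg ha]; split_ifs <;> linarith
  have hμ : ∀ a, μ a ∈ Set.Icc (0 : ℝ) (1 / 2) := fun a =>
    ⟨hμlow a, (hμhigh a).trans (by linarith)⟩
  let PA : Fin (m + 1) → Fin k → (ℕ → Fin k) → Prop := fun j c a =>
    ∀ u, t j ≤ u → u < t (j + 1) → a u ≠ c
  let PB : (ℕ → Fin k) → Prop := fun a => ∀ u, t (m + 1) ≤ u → u < T → a u ≠ i₁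
  let PC : (ℕ → Fin k) → Prop := fun a => ∃ s, t m ≤ s ∧ s < t (m + 1) ∧
    (∀ u, t m ≤ u → u < s → a u ≠ i₁) ∧ a s = i₁ ∧ S ≤ switchesIn a 0 s
  let E : (Fin (m + 1) × Fin k) ⊕ Bool → Set (History k T) := Sum.elim
    (fun jc => {h | PA jc.1 jc.2 (h.actions jc.2)})
    (fun b => if b then {h | PB (h.actions i₁)} else {h | PC (h.actions i₁)})
  have hcover : ∀ᵐ h ∂(law π (signEnv μ hμ) T), ∃ e, h ∈ E e := by
    filter_upwards [hπ (signEnv μ hμ)] with h hh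
    rw [numSwitches_eq i₁] at hh
    rcases unvisited_or_abandoned_or_exhausted (h.actions i₁) t ht h0 m S T hS hk hh i₁ with
      ⟨j, hj, c, hc⟩ | hB | hC
    · refine ⟨Sum.inl (⟨j, by omega⟩, c), fun u hu1 hu2 => ?_⟩
      have huT : u < T := hu2.trans_le ((ht (show j + 1 ≤ m + 1 by omega)).trans htT)
      have := hc u hu1 hu2
      rwa [History.actions_of_lt _ _ huT] at this ⊢
    · exact ⟨Sum.inr true, hB⟩
    · exact ⟨Sum.inr false, hC⟩
  -- There are `(m + 1) k + 2 ≤ 2k(m + 1)` events.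
  obtain ⟨e, he⟩ := exists_le_measureReal _ E hcover (p := p) (by
    have : Fintype.card ((Fin (m + 1) × Fin k) ⊕ Bool) = (m + 1) * k + 2 := by simp
    rw [this, hp, div_mul_eq_mul_div, one_mul, div_le_one (by positivity)]
    push_cast
    nlinarith)
  rcases e with ⟨j, c⟩ | b
  · have hj : (j : ℕ) ≤ m := by omega
    have hδj := hδm j hj
    set ν := Function.update μ c (2 * d + δ j) with hν'
    have hνc : ν c = 2 * d + δ j := by simp [hν']
    have hνa : ∀ a ≠ c, ν a = μ a := fun a ha => by simp [hν', ha]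
    have hν : ∀ a, ν a ∈ Set.Icc (0 : ℝ) (1 / 2) := fun a => by
      by_cases ha : a = c
      · rw [ha, hνc]
        constructor <;> linarith [hδ0 j, hδ1 j]
      · rw [hνa a ha]; exact hμ a
    have hEm : MeasurableSet {h : History k T | PA j c (h.actions c)} :=
      measurableSet_of_actions c _
    have hlow := le_law_real_signEnv (t := t j) π hμ hν c (fun a ha => (hνa a ha).symm) hEm
      (stoppedAt_indicator (PA j c) (by
        intro s hs a b hab ha hb hPa u hu1 hu2
        -- If `c` is avoided in block `j`, its next play at or after `t j` falls after the block,
        -- when the event is already decided.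
        have hts : t (j + 1) ≤ s := by
          by_contra hlt
          exact hPa s hs (not_le.1 hlt) ha
        rw [← hab u (by omega)]
        exact hPa u hu1 hu2))
      (by
        -- Since `d ≤ δ j`, the mean of `c` moves by at most `3 δ j`; this is the origin of the
        -- bound `1 / 18`.
        have h1 : (μ c - ν c) ^ 2 ≤ 9 * δ j ^ 2 := by
          rw [hνc]
          have := hμlow c
          have := hμhigh c
          nlinarith [hδ0 j]
        have := mul_le_mul_of_nonneg_right h1 (Nat.cast_nonneg (α := ℝ) (t j))
        linarith [hδt j hj])
      hp0.le he
    obtain ⟨c', hc'⟩ : ∃ c', c' ≠ c := by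
      by_cases hc : i₁ = c
      · exact ⟨i₂, hc ▸ h12.symm⟩
      · exact ⟨i₁, hc⟩
    refine le_iSup_gap_mul_regret π (signEnv ν hν) hc' (hδ0 j) (fun a ha => ?_) hEm c
      (ht (Nat.le_succ j)) ((ht (show (j : ℕ) + 1 ≤ m + 1 by omega)).trans htT)
      (ae_of_all _ fun h hh => hh) ?_
    · rw [mean_signEnv, mean_signEnv, hνc, hνa a ha]
      linarith [hμhigh a]
    · exact mul_le_mul (hLj j hj) hlow (by positivity) (hL.trans (hLj j hj))
  · cases b with
    | true =>
      refine le_iSup_gap_mul_regret π (signEnv μ hμ) h12.symm hd0 (fun a ha => ?_)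
        (measurableSet_of_actions i₁ PB) i₁ htT le_rfl (ae_of_all _ fun h hh => hh) ?_
      · rw [mean_signEnv, mean_signEnv, hμ1]
        linarith [hμne a ha]
      · exact mul_le_mul hLm (hqp.trans he) (by positivity) (hL.trans hLm)
    | false =>
      set ν := Function.update μ i₁ 0 with hν'
      have hνc : ν i₁ = 0 := by simp [hν']
      have hνa : ∀ a ≠ i₁, ν a = μ a := fun a ha => by simp [hν', ha]
      have hν : ∀ a, ν a ∈ Set.Icc (0 : ℝ) (1 / 2) := fun a => by
        by_cases ha : a = i₁
        · rw [ha, hνc]; norm_num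
        · rw [hνa a ha]; exact hμ a
      have hEm : MeasurableSet {h : History k T | PC (h.actions i₁)} :=
        measurableSet_of_actions i₁ _
      have hlow := le_law_real_signEnv (t := t m) π hμ hν i₁ (fun a ha => (hνa a ha).symm) hEm
        (stoppedAt_indicator PC (by
          rintro s₀ hs₀ a b hab ha hb ⟨s, hs1, hs2, hs3, hs4, hs5⟩
          -- The event is decided at the first play `s` of `i₁` in the last block, which uses no
          -- reward of `i₁` from `t m` on.
          have hss : s ≤ s₀ := by
            by_contra hlt
            exact hs3 s₀ hs₀ (not_le.1 hlt) ha
          have hag : ∀ u, u ≤ s → a u = b u := fun u hu => by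
            rcases (hu.trans hss).lt_or_eq with h | h
            · exact hab u h
            · rw [h, ha, hb]
          refine ⟨s, hs1, hs2, fun u hu1 hu2 => ?_, ?_, ?_⟩
          · rw [← hag u hu2.le]; exact hs3 u hu1 hu2
          · rw [← hag s le_rfl]; exact hs4
          · rwa [← switchesIn_congr hag]))
        (by
          rw [hνc, hμ1]
          nlinarith [hδt m le_rfl])
        hp0.le he
      refine le_iSup_gap_mul_regret π (signEnv ν hν) h12 hd0 (fun a ha => ?_) hEm i₁
        htT le_rfl ?_ ?_
      · rw [mean_signEnv, mean_signEnv, hνa i₂ h12.symm, hμ2]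
        by_cases ha1 : a = i₁
        · rw [ha1, hνc]; linarith
        · rw [hνa a ha1]; simp [hμdef, ha, ha1]
      -- The budget also binds in the altered environment: once it is spent at `s`, the policy plays
      -- `i₁` forever.
      · filter_upwards [hπ (signEnv ν hν)] with h hh
        rintro ⟨s, hs1, hs2, hs3, hs4, hs5⟩ u hu1 hu2
        rw [numSwitches_eq i₁] at hh
        rw [eq_of_switchesIn_le _ hs5 hh (show s ≤ u by omega) (by omega), hs4]
        exact h12
      · exact mul_le_mul hLm hlow (by positivity) (hL.trans hLm)

/-! ### Geometric blocks -/

lemma le_mul_of_switchIndex {k S : ℕ} (hk : 2 ≤ k) :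
    S ≤ (switchIndex k S + 1) * (k - 1) := by
  have h := Nat.lt_floor_add_one (((S : ℝ) - 1) / ((k : ℝ) - 1))
  have hk' : (2 : ℝ) ≤ k := by exact_mod_cast hk
  rw [div_lt_iff₀ (by linarith)] at h
  change (S : ℝ) - 1 < ((switchIndex k S : ℝ) + 1) * (k - 1) at h
  have h2 : (S : ℝ) < (((switchIndex k S + 1) * (k - 1) + 1 : ℕ) : ℝ) := by
    push_cast [Nat.cast_sub (show 1 ≤ k by omega)]
    linarith
  have h3 : S < (switchIndex k S + 1) * (k - 1) + 1 := by exact_mod_cast h2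
  omega

/-- The ends of blocks of geometrically increasing length. -/
noncomputable def blockEnd (r : ℝ) (j : ℕ) : ℕ := ⌊r ^ j⌋₊ + j - 1

lemma cast_blockEnd {r : ℝ} (hr : 1 ≤ r) (j : ℕ) :
    (blockEnd r j : ℝ) = (⌊r ^ j⌋₊ : ℝ) + j - 1 := by
  have : 1 ≤ ⌊r ^ j⌋₊ := Nat.le_floor (by simpa using one_le_pow₀ hr)
  rw [blockEnd, Nat.cast_sub (by omega)]
  push_cast
  ring

lemma blockEnd_zero (r : ℝ) : blockEnd r 0 = 0 := by simp [blockEnd]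

lemma monotone_blockEnd {r : ℝ} (hr : 1 ≤ r) : Monotone (blockEnd r) := by
  intro i j hij
  have := Nat.floor_mono (pow_le_pow_right₀ hr hij)
  unfold blockEnd
  omega

/-- Here the assumption `m ≤ log₂ (T / k)` keeps `r` away from `1`, so that the blocks really grow.
-/
lemma two_le_sq {r : ℝ} {m : ℕ} (hr : 1 ≤ r) (hm : 1 ≤ m) (h : (2 : ℝ) ^ m ≤ r ^ (m + 1)) :
    2 ≤ r ^ 2 := by
  have h1 : (2 : ℝ) ^ m ≤ (r ^ 2) ^ m := by
    rw [← pow_mul]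
    exact h.trans (pow_le_pow_right₀ hr (by omega))
  exact (pow_le_pow_iff_left₀ (by norm_num) (by positivity) (by omega)).1 h1

lemma blockEnd_le {r : ℝ} {m : ℕ} (hr : 1 ≤ r) (h : (2 : ℝ) ^ m ≤ r ^ (m + 1)) {j : ℕ}
    (hj : j ≤ m) : (blockEnd r j : ℝ) ≤ 4 * r ^ j := by
  rcases Nat.eq_zero_or_pos j with rfl | hj0
  · simp [blockEnd_zero]
  · have h2 := two_le_sq hr (hj0.trans_le hj) h
    have h3 : 4 / 3 ≤ r := by nlinarith
    -- Bernoulli with `r ≥ 4/3` gives `j ≤ 3 (r ^ j - 1)`, which absorbs the summand `j`.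
    have h4 := one_add_mul_le_pow (show (-2 : ℝ) ≤ r - 1 by linarith) j
    rw [add_sub_cancel] at h4
    have h5 : (⌊r ^ j⌋₊ : ℝ) ≤ r ^ j := Nat.floor_le (by positivity)
    rw [cast_blockEnd hr]
    nlinarith [Nat.cast_nonneg (α := ℝ) j]

/-- The summand `j` in `blockEnd` offsets the rounding: for `j ≥ 1` the block is longer than `r ^ (j
+ 1) - r ^ j`, and `r ≥ 4/3`. -/
lemma pow_div_four_le_blockEnd_sub {r : ℝ} {m : ℕ} (hr : 1 ≤ r)
    (h : (2 : ℝ) ^ m ≤ r ^ (m + 1)) {j : ℕ} (hj : j ≤ m) :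
    r ^ (j + 1) / 4 ≤ (blockEnd r (j + 1) : ℝ) - blockEnd r j := by
  have h1 : r ^ (j + 1) < (⌊r ^ (j + 1)⌋₊ : ℝ) + 1 := Nat.lt_floor_add_one _
  rw [cast_blockEnd hr, cast_blockEnd hr]
  push_cast
  rcases Nat.eq_zero_or_pos j with rfl | hj0
  · have h3 : (1 : ℝ) ≤ ⌊r ^ (0 + 1)⌋₊ := by
      exact_mod_cast Nat.le_floor (by simpa using hr)
    simp only [pow_zero, Nat.floor_one, zero_add, Nat.cast_one, Nat.cast_zero] at *
    linarith
  · have h2 := two_le_sq hr (hj0.trans_le hj) h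
    have h3 : 4 / 3 ≤ r := by nlinarith
    have h5 : (⌊r ^ j⌋₊ : ℝ) ≤ r ^ j := Nat.floor_le (by positivity)
    have h6 : r ^ (j + 1) = r ^ j * r := pow_succ r j
    have h7 : 0 < r ^ j := by positivity
    nlinarith

/-- The blocks end by `r ^ (m + 1) + m ≤ (3/2) r ^ (m + 1)`, while `T = k r ^ (m + 1) ≥ 2 r ^ (m +
1)`. -/
lemma pow_div_four_le_sub_blockEnd {k m T : ℕ} {r : ℝ} (hr : 1 ≤ r) (hk : 2 ≤ k)
    (h : (2 : ℝ) ^ m ≤ r ^ (m + 1)) (hrT : r ^ (m + 1) = (T : ℝ) / k) :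
    r ^ (m + 1) / 4 ≤ (T : ℝ) - blockEnd r (m + 1) := by
  have hk' : (2 : ℝ) ≤ k := by exact_mod_cast hk
  have h1 : (⌊r ^ (m + 1)⌋₊ : ℝ) ≤ r ^ (m + 1) := Nat.floor_le (by positivity)
  have h2 : 2 * r ^ (m + 1) ≤ T := by
    rw [hrT, mul_div_assoc', div_le_iff₀ (by linarith)]
    nlinarith [Nat.cast_nonneg (α := ℝ) T]
  have h3 : 2 * (m : ℝ) ≤ r ^ (m + 1) := by
    refine le_trans ?_ h
    rcases m with _ | m
    · simp
    · have : m + 1 ≤ 2 ^ m := Nat.lt_two_pow_self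
      have h' : ((m + 1 : ℕ) : ℝ) ≤ 2 ^ m := by exact_mod_cast this
      rw [pow_succ]
      linarith
  rw [cast_blockEnd hr]
  push_cast
  have : 0 < r ^ (m + 1) := by positivity
  linarith

end BwSC

theorem theorem7 :
    ∃ C : ℝ, 0 < C ∧
      ∀ k S T : ℕ, 2 ≤ k → 1 ≤ T →
      ∀ π : BwSC.Policy k, BwSC.IsSwitchPolicy S T π →
        (BwSC.switchIndex k S : ℝ) ≤ Real.logb 2 ((T : ℝ) / (k : ℝ)) →
        ((C * ((k : ℝ) ^ (-(3 / 2 : ℝ) - 1 / ((BwSC.switchIndex k S : ℝ) + 1))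
              * ((BwSC.switchIndex k S : ℝ) + 1) ^ (-2 : ℝ))
            * (T : ℝ) ^ (1 / ((BwSC.switchIndex k S : ℝ) + 1)) : ℝ) : EReal)
          ≤ ⨆ (D : BwSC.Env k) (i : Fin k) (_ : D.IsOptimal i) (_ : D.gap i ∈ Set.Ioc (0 : ℝ) 1),
              ((D.gap i * BwSC.regret π D T : ℝ) : EReal) := by
  refine ⟨1 / 1024 * (Real.exp (-1) / 2) ^ (3 / 2 : ℝ), by positivity, ?_⟩
  intro k S T hk hT π hπ hm
  have hS := BwSC.le_mul_of_switchIndex (S := S) hk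
  generalize BwSC.switchIndex k S = m at hm hS ⊢
  have hkR : (2 : ℝ) ≤ k := by exact_mod_cast hk
  have hk0 : (0 : ℝ) < k := by linarith
  have hTR : (1 : ℝ) ≤ T := by exact_mod_cast hT
  have hTk : (2 : ℝ) ^ m ≤ (T : ℝ) / k := by
    rw [Real.le_logb_iff_rpow_le (by norm_num) (by positivity)] at hm
    exact_mod_cast hm
  have hTk1 : (1 : ℝ) ≤ (T : ℝ) / k := le_trans (one_le_pow₀ (by norm_num)) hTk
  set r : ℝ := ((T : ℝ) / k) ^ (1 / ((m : ℝ) + 1)) with hrdef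
  have hr : 1 ≤ r := Real.one_le_rpow hTk1 (by positivity)
  have hr0 : 0 < r := by linarith
  have hrT : r ^ (m + 1) = (T : ℝ) / k := by
    rw [hrdef, ← Real.rpow_natCast, ← Real.rpow_mul (by positivity)]
    push_cast
    rw [one_div_mul_cancel (by positivity), Real.rpow_one]
  rw [← hrT] at hTk
  -- The factor `1/16` gives `δ j ^ 2 * blockEnd r j ≤ 4 / 256 ≤ 1 / 18`.
  set δ : ℕ → ℝ := fun j => 1 / 16 / Real.sqrt (r ^ j) with hδ
  have hδsq : ∀ j, δ j ^ 2 = 1 / 256 / r ^ j := fun j => by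
    simp only [hδ, div_pow, Real.sq_sqrt (pow_pos hr0 j).le]
    norm_num
  have hscale : ∀ j, δ j ^ 2 * (r ^ (j + 1) / 4) = r / 1024 := fun j => by
    rw [hδsq, pow_succ]
    field_simp
    norm_num
  have hsub := BwSC.pow_div_four_le_sub_blockEnd hr hk hTk hrT
  have key := BwSC.le_iSup_of_schedule hk hT hS π hπ (BwSC.blockEnd r) (BwSC.monotone_blockEnd hr)
    (BwSC.blockEnd_zero r)
    (by
      have : (0 : ℝ) < r ^ (m + 1) := by positivity
      have h : (BwSC.blockEnd r (m + 1) : ℝ) ≤ T := by linarith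
      exact_mod_cast h)
    δ (fun j => by positivity)
    (fun j => div_le_self (by norm_num) (Real.one_le_sqrt.2 (one_le_pow₀ hr)))
    (fun j hj => div_le_div_of_nonneg_left (by norm_num) (by positivity)
      (Real.sqrt_le_sqrt (pow_le_pow_right₀ hr hj)))
    (fun j hj => by
      refine (mul_le_mul_of_nonneg_left (BwSC.blockEnd_le hr hTk hj) (sq_nonneg _)).trans ?_
      have : r ^ j ≠ 0 := by positivity
      rw [hδsq]
      field_simp
      norm_num)
    (L := r / 1024) (by positivity)
    (fun j hj => by
      rw [← hscale j]
      exact mul_le_mul_of_nonneg_left (BwSC.pow_div_four_le_blockEnd_sub hr hTk hj) (sq_nonneg _))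
    (by
      rw [← hscale m]
      exact mul_le_mul_of_nonneg_left hsub (sq_nonneg _))
  refine le_trans (EReal.coe_le_coe_iff.2 ?_) key
  have hm1 : (1 : ℝ) ≤ (m : ℝ) + 1 := by linarith [Nat.cast_nonneg (α := ℝ) m]
  have e1 : (1 / (2 * k * (m + 1)) * Real.exp (-1) : ℝ) ^ (3 / 2 : ℝ) =
      (Real.exp (-1) / 2) ^ (3 / 2 : ℝ) * ((k : ℝ) ^ (-(3 / 2 : ℝ)) *
        ((m : ℝ) + 1) ^ (-(3 / 2 : ℝ))) := by
    rw [Real.rpow_neg hk0.le, Real.rpow_neg (by positivity), ← Real.inv_rpow hk0.le,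
      ← Real.inv_rpow (by positivity), ← Real.mul_rpow (by positivity) (by positivity),
      ← Real.mul_rpow (by positivity) (by positivity)]
    congr 1
    field_simp
  have e2 : r = (k : ℝ) ^ (-(1 / ((m : ℝ) + 1))) * (T : ℝ) ^ (1 / ((m : ℝ) + 1)) := by
    rw [hrdef, Real.div_rpow (by positivity) hk0.le, Real.rpow_neg hk0.le]
    field_simp
  have e3 : (k : ℝ) ^ (-(3 / 2 : ℝ) - 1 / ((m : ℝ) + 1)) =
      (k : ℝ) ^ (-(3 / 2 : ℝ)) * (k : ℝ) ^ (-(1 / ((m : ℝ) + 1))) := by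
    rw [← Real.rpow_add hk0, sub_eq_add_neg]
  -- The argument yields the exponent `-3/2` for `m + 1`; the claimed `-2` is weaker.
  have h4 : ((m : ℝ) + 1) ^ (-2 : ℝ) ≤ ((m : ℝ) + 1) ^ (-(3 / 2 : ℝ)) :=
    Real.rpow_le_rpow_of_exponent_le hm1 (by norm_num)
  rw [e1, e3]
  calc _ = r / 1024 * ((Real.exp (-1) / 2) ^ (3 / 2 : ℝ) * ((k : ℝ) ^ (-(3 / 2 : ℝ)) *
        ((m : ℝ) + 1) ^ (-2 : ℝ))) := by rw [e2]; ring
    _ ≤ _ := by gcongr
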